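/- \textbf{Theorem (disk bijectivity).} Let $\bar{\mathbb D}=\{z\in\mathbb C:|z|\le 1\}$, $\alpha=1+i$, and let $\bar{\mathbb C}=\mathbb C\cup\{\infty\}$. Define $$V_0=\bar{\mathbb D},\quad V_1=\{w\in\bar{\mathbb D}:|w+\alpha|\ge 1\},\quad V_5=V_1\cap V_2,\quad V_j=-i\,V_{j-1}\ (j=2,3,4,6,7,8),$$ $$E_0=\{0\},\quad E_1=\{n\alpha:n\in\mathbb Z,\ n>0\},\quad E_5=\{n\alpha+m\bar\alpha:n,m\in\mathbb Z,\ n,m>0\},\quad E_j=-i\,E_{j-1}\ (j=2,3,4,6,7,8).$$ The sets $E_0,\dots,E_8$ partition the set of Gaussian integers $x+yi$ with $x+y$ even; for such an $a$ let $V(a)=V_j$, where $a\in E_j$. The choice function of Tanaka's disk algorithm is a function $\langle\cdot\rangle:\mathbb C\setminus\{0\}\to\bigcup_j E_j$ such that $w\in\langle w\rangle+V(\langle w\rangle)$ for all $w\ne0$; it is determined except on boundary arcs of the sets $a+V(a)$, where any choice is allowed. Put $S(z)=-1/z$, $T^a(z)=z+a$, and $$\hat G(z,w)=(T^{-a}Sz,\;T^{-a}Sw),\qquad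 a=\langle Sz\rangle .$$ Partition the closed unit disk into $$K_2=\{z\in\bar{\mathbb D}:|z-(-1+i)|\le1\},\quad K_i=-i\,K_{i-1}\ (i=3,4,5),\quad K_1=\bar{\mathbb D}\setminus(K_2\cup K_3\cup K_4\cup K_5),$$ and, with $B(c,r)$ the open disk of radius $r$ centered at $c$, let $$L_1=\bar{\mathbb C}\setminus\Big(B\big(\tfrac{1+i}2,\tfrac1{\sqrt2}\big)\cup B\big(\tfrac{-1+i}2,\tfrac1{\sqrt2}\big)\cup B\big(\tfrac{-1-i}2,\tfrac1{\sqrt2}\big)\cup B\big(\tfrac{1-i}2,\tfrac1{\sqrt2}\big)\Big),$$ $$L_2=L_1\setminus\{w\in\mathbb C:\operatorname{Im}w>\operatorname{Re}w+1\},\qquad L_i=-i\,L_{i-1}\ (i=3,4,5).$$ Then $\hat G$ is bijective almost everywhere on $\Omega=\bigcup_{i=1}^5K_i\times L_i$: there is a set $N$ that is null for Lebesgue measure on $\mathbb C\times\mathbb C$ (extended by zero to the points with second coordinate $\infty$) such that $\hat G$ restricts to a bijection of $\Omega\setminus N$ onto itself. -/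

import Mathlib

open MeasureTheory

noncomputable section

namespace DiskCF

/-- The Gaussian integer `1 + i`. -/
def α : GaussianInt := ⟨1, 1⟩

/-- The Gaussian integer `1 - i`, the conjugate of `α`. -/
def αbar : GaussianInt := ⟨1, -1⟩

/-- The Gaussian integer `i`. -/
def gI : GaussianInt := ⟨0, 1⟩

/-- The sets `V₀, …, V₈` (only the indices `j ≤ 8` are used). -/
def V : ℕ → Set ℂ
  | 0 => Metric.closedBall 0 1
  | 1 => {w | w ∈ Metric.closedBall (0 : ℂ) 1 ∧ 1 ≤ ‖w + (1 + Complex.I)‖}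
  | 5 => V 1 ∩ V 2
  | (j + 1) => (fun w : ℂ => -Complex.I * w) '' V j

/-- The sets `E₀, …, E₈` that partition the even Gaussian integers
(only the indices `j ≤ 8` are used). -/
def E : ℕ → Set GaussianInt
  | 0 => {0}
  | 1 => {a | ∃ n : ℤ, 0 < n ∧ a = (n : GaussianInt) * α}
  | 5 => {a | ∃ n m : ℤ, 0 < n ∧ 0 < m ∧
      a = (n : GaussianInt) * α + (m : GaussianInt) * αbar}
  | (j + 1) => (fun a : GaussianInt => -gI * a) '' E j

/-- `c` is a choice function of the disk algorithm: for every `w ≠ 0`, the digit `c w` is an even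
Gaussian integer `a` with `w ∈ a + V(a)`, where `V(a) = V j` for the index `j` with `a ∈ E j`.
The sets `a + V(a)` cover the plane and overlap only in boundary arcs, so this determines `c`
except for the way in which ties on these arcs are broken; any tie-breaking is allowed.
The value `c 0` is irrelevant. -/
def IsDiskChoice (c : ℂ → GaussianInt) : Prop :=
  ∀ w : ℂ, w ≠ 0 → ∃ j : ℕ, j ≤ 8 ∧ c w ∈ E j ∧ w - (c w : ℂ) ∈ V j

theorem mem_V_iff (w : ℂ) :
    (w ∈ V 0 ↔ ‖w‖ ≤ 1) ∧
    (w ∈ V 1 ↔ ‖w‖ ≤ 1 ∧ 1 ≤ ‖w + (1 + Complex.I)‖) ∧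
    (w ∈ V 2 ↔ ‖w‖ ≤ 1 ∧ 1 ≤ ‖w + (1 - Complex.I)‖) ∧
    (w ∈ V 3 ↔ ‖w‖ ≤ 1 ∧ 1 ≤ ‖w - (1 + Complex.I)‖) ∧
    (w ∈ V 4 ↔ ‖w‖ ≤ 1 ∧ 1 ≤ ‖w - (1 - Complex.I)‖) ∧
    (w ∈ V 5 ↔ ‖w‖ ≤ 1 ∧ 1 ≤ ‖w + (1 + Complex.I)‖ ∧ 1 ≤ ‖w + (1 - Complex.I)‖) ∧
    (w ∈ V 6 ↔ ‖w‖ ≤ 1 ∧ 1 ≤ ‖w + (1 - Complex.I)‖ ∧ 1 ≤ ‖w - (1 + Complex.I)‖) ∧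
    (w ∈ V 7 ↔ ‖w‖ ≤ 1 ∧ 1 ≤ ‖w - (1 + Complex.I)‖ ∧ 1 ≤ ‖w - (1 - Complex.I)‖) ∧
    (w ∈ V 8 ↔ ‖w‖ ≤ 1 ∧ 1 ≤ ‖w - (1 - Complex.I)‖ ∧ 1 ≤ ‖w + (1 + Complex.I)‖) := by
  have hI : Complex.I * Complex.I = -1 := Complex.I_mul_I
  have key : ∀ (A : Set ℂ) (z : ℂ),
      z ∈ (fun w : ℂ => -Complex.I * w) '' A ↔ Complex.I * z ∈ A := by
    intro A z
    constructor
    · rintro ⟨y, hy, rfl⟩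
      have : Complex.I * (-Complex.I * y) = y := by linear_combination (-y) * hI
      simpa only [this] using hy
    · intro h
      exact ⟨_, h, by linear_combination (-z) * hI⟩
  have nI : ∀ z : ℂ, ‖Complex.I * z‖ = ‖z‖ := fun z => by simp
  have e1 : ∀ z : ℂ, ‖Complex.I * z + (1 + Complex.I)‖ = ‖z + (1 - Complex.I)‖ := fun z => by
    rw [← nI (z + (1 - Complex.I))]; congr 1; linear_combination hI
  have e2 : ∀ z : ℂ, ‖Complex.I * z + (1 - Complex.I)‖ = ‖z - (1 + Complex.I)‖ := fun z => by
    rw [← nI (z - (1 + Complex.I))]; congr 1; linear_combination hI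
  have e3 : ∀ z : ℂ, ‖Complex.I * z - (1 + Complex.I)‖ = ‖z - (1 - Complex.I)‖ := fun z => by
    rw [← nI (z - (1 - Complex.I))]; congr 1; linear_combination -hI
  have e4 : ∀ z : ℂ, ‖Complex.I * z - (1 - Complex.I)‖ = ‖z + (1 + Complex.I)‖ := fun z => by
    rw [← nI (z + (1 + Complex.I))]; congr 1; linear_combination -hI
  have h0 : ∀ z, z ∈ V 0 ↔ ‖z‖ ≤ 1 := fun z => by simp [V]
  have h1 : ∀ z, z ∈ V 1 ↔ ‖z‖ ≤ 1 ∧ 1 ≤ ‖z + (1 + Complex.I)‖ := fun z => by simp [V]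
  have h2 : ∀ z, z ∈ V 2 ↔ ‖z‖ ≤ 1 ∧ 1 ≤ ‖z + (1 - Complex.I)‖ := fun z => by
    rw [show V 2 = (fun w : ℂ => -Complex.I * w) '' V 1 from by simp [V], key, h1, nI, e1]
  have h3 : ∀ z, z ∈ V 3 ↔ ‖z‖ ≤ 1 ∧ 1 ≤ ‖z - (1 + Complex.I)‖ := fun z => by
    rw [show V 3 = (fun w : ℂ => -Complex.I * w) '' V 2 from by simp [V], key, h2, nI, e2]
  have h4 : ∀ z, z ∈ V 4 ↔ ‖z‖ ≤ 1 ∧ 1 ≤ ‖z - (1 - Complex.I)‖ := fun z => by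
    rw [show V 4 = (fun w : ℂ => -Complex.I * w) '' V 3 from by simp [V], key, h3, nI, e3]
  have h5 : ∀ z, z ∈ V 5 ↔ ‖z‖ ≤ 1 ∧ 1 ≤ ‖z + (1 + Complex.I)‖ ∧
      1 ≤ ‖z + (1 - Complex.I)‖ := fun z => by
    rw [show V 5 = V 1 ∩ V 2 from by simp [V], Set.mem_inter_iff, h1, h2]; tauto
  have h6 : ∀ z, z ∈ V 6 ↔ ‖z‖ ≤ 1 ∧ 1 ≤ ‖z + (1 - Complex.I)‖ ∧
      1 ≤ ‖z - (1 + Complex.I)‖ := fun z => by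
    rw [show V 6 = (fun w : ℂ => -Complex.I * w) '' V 5 from by simp [V], key, h5, nI, e1, e2]
  have h7 : ∀ z, z ∈ V 7 ↔ ‖z‖ ≤ 1 ∧ 1 ≤ ‖z - (1 + Complex.I)‖ ∧
      1 ≤ ‖z - (1 - Complex.I)‖ := fun z => by
    rw [show V 7 = (fun w : ℂ => -Complex.I * w) '' V 6 from by simp [V], key, h6, nI, e2, e3]
  have h8 : ∀ z, z ∈ V 8 ↔ ‖z‖ ≤ 1 ∧ 1 ≤ ‖z - (1 - Complex.I)‖ ∧
      1 ≤ ‖z + (1 + Complex.I)‖ := fun z => by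
    rw [show V 8 = (fun w : ℂ => -Complex.I * w) '' V 7 from by simp [V], key, h7, nI, e3, e4]
  exact ⟨h0 w, h1 w, h2 w, h3 w, h4 w, h5 w, h6 w, h7 w, h8 w⟩

theorem mem_E (n m : ℤ) :
    (n = 0 → m = 0 → (⟨n + m, n - m⟩ : GaussianInt) ∈ E 0) ∧
    (0 < n → m = 0 → (⟨n + m, n - m⟩ : GaussianInt) ∈ E 1) ∧
    (n = 0 → 0 < m → (⟨n + m, n - m⟩ : GaussianInt) ∈ E 2) ∧
    (n < 0 → m = 0 → (⟨n + m, n - m⟩ : GaussianInt) ∈ E 3) ∧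
    (n = 0 → m < 0 → (⟨n + m, n - m⟩ : GaussianInt) ∈ E 4) ∧
    (0 < n → 0 < m → (⟨n + m, n - m⟩ : GaussianInt) ∈ E 5) ∧
    (n < 0 → 0 < m → (⟨n + m, n - m⟩ : GaussianInt) ∈ E 6) ∧
    (n < 0 → m < 0 → (⟨n + m, n - m⟩ : GaussianInt) ∈ E 7) ∧
    (0 < n → m < 0 → (⟨n + m, n - m⟩ : GaussianInt) ∈ E 8) := by
  have h0 : ∀ n m : ℤ, n = 0 → m = 0 → (⟨n + m, n - m⟩ : GaussianInt) ∈ E 0 := by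
    rintro n m rfl rfl
    rw [E]; rfl
  have h1 : ∀ n m : ℤ, 0 < n → m = 0 → (⟨n + m, n - m⟩ : GaussianInt) ∈ E 1 := by
    rintro n m hn rfl
    rw [E]
    exact ⟨n, hn, by ext <;> simp [α]⟩
  have h5 : ∀ n m : ℤ, 0 < n → 0 < m → (⟨n + m, n - m⟩ : GaussianInt) ∈ E 5 := by
    intro n m hn hm
    rw [E]
    exact ⟨n, m, hn, hm, by ext <;> simp [α, αbar, sub_eq_add_neg]⟩
  have st : ∀ (j : ℕ) (n m : ℤ), E (j + 1) = (fun a : GaussianInt => -gI * a) '' E j →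
      (⟨m + -n, m - -n⟩ : GaussianInt) ∈ E j → (⟨n + m, n - m⟩ : GaussianInt) ∈ E (j + 1) := by
    intro j n m h hm
    rw [h]
    exact ⟨_, hm, by ext <;> simp [gI] <;> ring⟩
  have h2 : ∀ n m : ℤ, n = 0 → 0 < m → (⟨n + m, n - m⟩ : GaussianInt) ∈ E 2 :=
    fun n m hn hm => st 1 n m (by simp [E]) (h1 _ _ (by omega) (by omega))
  have h3 : ∀ n m : ℤ, n < 0 → m = 0 → (⟨n + m, n - m⟩ : GaussianInt) ∈ E 3 :=
    fun n m hn hm => st 2 n m (by simp [E]) (h2 _ _ (by omega) (by omega))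
  have h4 : ∀ n m : ℤ, n = 0 → m < 0 → (⟨n + m, n - m⟩ : GaussianInt) ∈ E 4 :=
    fun n m hn hm => st 3 n m (by simp [E]) (h3 _ _ (by omega) (by omega))
  have h6 : ∀ n m : ℤ, n < 0 → 0 < m → (⟨n + m, n - m⟩ : GaussianInt) ∈ E 6 :=
    fun n m hn hm => st 5 n m (by simp [E]) (h5 _ _ (by omega) (by omega))
  have h7 : ∀ n m : ℤ, n < 0 → m < 0 → (⟨n + m, n - m⟩ : GaussianInt) ∈ E 7 :=
    fun n m hn hm => st 6 n m (by simp [E]) (h6 _ _ (by omega) (by omega))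
  have h8 : ∀ n m : ℤ, 0 < n → m < 0 → (⟨n + m, n - m⟩ : GaussianInt) ∈ E 8 :=
    fun n m hn hm => st 7 n m (by simp [E]) (h7 _ _ (by omega) (by omega))
  exact ⟨h0 n m, h1 n m, h2 n m, h3 n m, h4 n m, h5 n m, h6 n m, h7 n m, h8 n m⟩

/-- The disk algorithm has a choice function: the sets `a + V(a)` cover the plane. -/
theorem exists_isDiskChoice : ∃ c : ℂ → GaussianInt, IsDiskChoice c := by
  have main : ∀ w : ℂ, ∃ a : GaussianInt, ∃ j : ℕ, j ≤ 8 ∧ a ∈ E j ∧ w - (a : ℂ) ∈ V j := by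
    intro w
    let g : ℤ → ℤ → GaussianInt := fun n m => ⟨n + m, n - m⟩
    have gc : ∀ n m : ℤ, ((g n m : GaussianInt) : ℂ) =
        n * (1 + Complex.I) + m * (1 - Complex.I) := by
      intro n m
      simp only [g, GaussianInt.toComplex_def]
      push_cast
      ring
    have hex : ∃ k : ℕ, ∃ n m : ℤ, n.natAbs + m.natAbs = k ∧ ‖w - (g n m : ℂ)‖ ≤ 1 := by
      refine ⟨_, round ((w.re + w.im) / 2), round ((w.re - w.im) / 2), rfl, ?_⟩
      have a1 := abs_le.1 (abs_sub_round ((w.re + w.im) / 2))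
      have a2 := abs_le.1 (abs_sub_round ((w.re - w.im) / 2))
      rw [gc, ← sq_le_one_iff₀ (norm_nonneg _), ← Complex.normSq_eq_norm_sq, Complex.normSq_apply]
      simp
      nlinarith
    classical
    obtain ⟨n, m, hk, hn⟩ := Nat.find_spec hex
    have hmin : ∀ n' m' : ℤ, n'.natAbs + m'.natAbs < n.natAbs + m.natAbs →
        1 ≤ ‖w - (g n' m' : ℂ)‖ := by
      intro n' m' h
      by_contra hc
      exact Nat.find_min hex (hk ▸ h) ⟨n', m', rfl, (not_le.1 hc).le⟩
    have s1 : 0 < n → 1 ≤ ‖w - (g n m : ℂ) + (1 + Complex.I)‖ := fun h => by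
      have := hmin (n - 1) m (by omega)
      rw [gc] at this ⊢
      convert this using 2
      push_cast; ring
    have s3 : n < 0 → 1 ≤ ‖w - (g n m : ℂ) - (1 + Complex.I)‖ := fun h => by
      have := hmin (n + 1) m (by omega)
      rw [gc] at this ⊢
      convert this using 2
      push_cast; ring
    have s2 : 0 < m → 1 ≤ ‖w - (g n m : ℂ) + (1 - Complex.I)‖ := fun h => by
      have := hmin n (m - 1) (by omega)
      rw [gc] at this ⊢
      convert this using 2
      push_cast; ring
    have s4 : m < 0 → 1 ≤ ‖w - (g n m : ℂ) - (1 - Complex.I)‖ := fun h => by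
      have := hmin n (m + 1) (by omega)
      rw [gc] at this ⊢
      convert this using 2
      push_cast; ring
    obtain ⟨v0, v1, v2, v3, v4, v5, v6, v7, v8⟩ := mem_V_iff (w - (g n m : ℂ))
    obtain ⟨e0, e1, e2, e3, e4, e5, e6, e7, e8⟩ := mem_E n m
    refine ⟨g n m, ?_⟩
    rcases lt_trichotomy n 0 with h | h | h <;> rcases lt_trichotomy m 0 with h' | h' | h'
    · exact ⟨7, by norm_num, e7 h h', v7.2 ⟨hn, s3 h, s4 h'⟩⟩
    · exact ⟨3, by norm_num, e3 h h', v3.2 ⟨hn, s3 h⟩⟩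
    · exact ⟨6, by norm_num, e6 h h', v6.2 ⟨hn, s2 h', s3 h⟩⟩
    · exact ⟨4, by norm_num, e4 h h', v4.2 ⟨hn, s4 h'⟩⟩
    · exact ⟨0, by norm_num, e0 h h', v0.2 hn⟩
    · exact ⟨2, by norm_num, e2 h h', v2.2 ⟨hn, s2 h'⟩⟩
    · exact ⟨8, by norm_num, e8 h h', v8.2 ⟨hn, s4 h', s1 h⟩⟩
    · exact ⟨1, by norm_num, e1 h h', v1.2 ⟨hn, s1 h⟩⟩
    · exact ⟨5, by norm_num, e5 h h', v5.2 ⟨hn, s1 h, s2 h'⟩⟩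
  choose c hc using main
  exact ⟨c, fun w _ => hc w⟩

/-- `S w = -1 / w` on the Riemann sphere. -/
def S : OnePoint ℂ → OnePoint ℂ
  | none => ((0 : ℂ) : OnePoint ℂ)
  | some w => open Classical in if w = 0 then OnePoint.infty else ((-1 / w : ℂ) : OnePoint ℂ)

/-- The translation `T^a w = w + a` on the Riemann sphere, fixing `∞`. -/
def T (a : ℂ) : OnePoint ℂ → OnePoint ℂ := OnePoint.map (fun w : ℂ => w + a)

/-- The rotation `w ↦ -i w` of the Riemann sphere, fixing `∞`. -/
def rot : OnePoint ℂ → OnePoint ℂ := OnePoint.map (fun w : ℂ => -Complex.I * w)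

/-- The natural extension `(z, w) ↦ (T^{-a} S z, T^{-a} S w)`, `a = ⟨S z⟩`, of the Gauss map of a
choice function `c`. The first coordinate is finite; the formula is meaningful for `z ≠ 0`, and
its values on the null set `z = 0` play no role. -/
def Ghat (c : ℂ → GaussianInt) (p : ℂ × OnePoint ℂ) : ℂ × OnePoint ℂ :=
  (-1 / p.1 - (c (-1 / p.1) : ℂ), T (-(c (-1 / p.1) : ℂ)) (S p.2))

/-- The piece `K₂` of the closed unit disk. -/
def K₂ : Set ℂ := {z | z ∈ Metric.closedBall (0 : ℂ) 1 ∧ ‖z - (-1 + Complex.I)‖ ≤ 1}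

def K₃ : Set ℂ := (fun z : ℂ => -Complex.I * z) '' K₂

def K₄ : Set ℂ := (fun z : ℂ => -Complex.I * z) '' K₃

def K₅ : Set ℂ := (fun z : ℂ => -Complex.I * z) '' K₄

def K₁ : Set ℂ := Metric.closedBall 0 1 \ (K₂ ∪ K₃ ∪ K₄ ∪ K₅)

/-- The open disk of radius `1/√2` centered at `c`, as a subset of the Riemann sphere. -/
def B (c : ℂ) : Set (OnePoint ℂ) := (↑) '' Metric.ball c (1 / Real.sqrt 2)

/-- `L₁` is the Riemann sphere (with `∞`) minus four open disks. -/
def L₁ : Set (OnePoint ℂ) :=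
  Set.univ \ (B ((1 + Complex.I) / 2) ∪ B ((-1 + Complex.I) / 2) ∪
    B ((-1 - Complex.I) / 2) ∪ B ((1 - Complex.I) / 2))

/-- `L₂` is `L₁` minus an open half-plane. -/
def L₂ : Set (OnePoint ℂ) := L₁ \ ((↑) '' {w : ℂ | w.im > w.re + 1})

def L₃ : Set (OnePoint ℂ) := rot '' L₂

def L₄ : Set (OnePoint ℂ) := rot '' L₃

def L₅ : Set (OnePoint ℂ) := rot '' L₄

/-- The union of the five products `K_i × L_i`. -/
def Ω : Set (ℂ × OnePoint ℂ) :=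
  (K₁ ×ˢ L₁) ∪ (K₂ ×ˢ L₂) ∪ (K₃ ×ˢ L₃) ∪ (K₄ ×ˢ L₄) ∪ (K₅ ×ˢ L₅)

/-- `N` is a null set for Lebesgue measure on `ℂ × ℂ`, extended by zero to the points
`(z, ∞)` at infinity. -/
def IsNull (N : Set (ℂ × OnePoint ℂ)) : Prop :=
  volume {p : ℂ × ℂ | (p.1, (p.2 : OnePoint ℂ)) ∈ N} = 0

/-- `f` is bijective a.e. on `X`: after removal of a null set from `X`, it is a bijection of what
remains onto itself. -/
def BijectiveAE (f : ℂ × OnePoint ℂ → ℂ × OnePoint ℂ) (X : Set (ℂ × OnePoint ℂ)) : Prop :=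
  ∃ N : Set (ℂ × OnePoint ℂ), IsNull N ∧ Set.BijOn f (X \ N) (X \ N)

end DiskCF

end

namespace DiskCF

/-! Write z = s(1+i) + t(1-i). The digits a are then the integer vectors (n, m), |z|² = 2(s² + t²),
and S sends (s, t) to -(t, s)/(2(s² + t²)). The map Ĝ applies S to both coordinates and then one
common integer translation.

Under S the domain Ω becomes a set all of whose second coordinates (p, q) lie in the unit square
|p|, |q| < 1/2 (`inΩ_iff_inSΩ`). Integer translates of this square are disjoint and cover the plane
up to boundary. Hence the second coordinate of an image point reveals the digit that was subtracted.
This gives injectivity, and for surjectivity it singles out the only possible digit.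

It remains to see that the translates fit together: for each digit a, the part of SΩ over a + V(a),
translated by -a, is exactly the part of Ω whose second coordinate lies in the square translated by
-a. This is `translationStep`, a comparison of disks of squared radius 1/2 about lattice points.
With `InV.digit_unique`, the point found there really has digit a.

Boundaries and ties are avoided by removing every point with a coordinate on a circle or line with
integer coefficients, or with second coordinate ∞. Such circles and lines are countably many, hence
null. S and the integer translations permute them, so the remaining set can serve as source and
target at once. -/

/-! ### Coordinates along 1 + i and 1 - i -/

/-- The first coordinate of `z = s (1 + i) + t (1 - i)`. -/
noncomputable def sc (z : ℂ) : ℝ := (z.re + z.im) / 2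

/-- The second coordinate of `z = s (1 + i) + t (1 - i)`. -/
noncomputable def tc (z : ℂ) : ℝ := (z.re - z.im) / 2

/-- The point with coordinates `s, t` lies on no circle or line with integer coefficients. -/
def Generic (s t : ℝ) : Prop :=
  ∀ a b c d : ℤ, a * (s ^ 2 + t ^ 2) + b * s + c * t + d = 0 → a = 0 ∧ b = 0 ∧ c = 0 ∧ d = 0

/-- `V(a)` for `a = n (1 + i) + m (1 - i)`, up to boundary arcs, in coordinates. -/
def InV (n m : ℤ) (s t : ℝ) : Prop :=
  s ^ 2 + t ^ 2 < 1 / 2 ∧ (0 < n → 1 / 2 ≤ (s + 1) ^ 2 + t ^ 2) ∧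
    (n < 0 → 1 / 2 ≤ (s - 1) ^ 2 + t ^ 2) ∧ (0 < m → 1 / 2 ≤ s ^ 2 + (t + 1) ^ 2) ∧
    (m < 0 → 1 / 2 ≤ s ^ 2 + (t - 1) ^ 2)

/-- `Ω` up to boundary points, in coordinates. -/
def InΩ (s t p q : ℝ) : Prop :=
  s ^ 2 + t ^ 2 < 1 / 2 ∧
    (p < p ^ 2 + q ^ 2 ∧ -p < p ^ 2 + q ^ 2 ∧ q < p ^ 2 + q ^ 2 ∧ -q < p ^ 2 + q ^ 2) ∧
    ((s - 1) ^ 2 + t ^ 2 < 1 / 2 → p < 1 / 2) ∧ ((s + 1) ^ 2 + t ^ 2 < 1 / 2 → -p < 1 / 2) ∧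
    (s ^ 2 + (t - 1) ^ 2 < 1 / 2 → q < 1 / 2) ∧ (s ^ 2 + (t + 1) ^ 2 < 1 / 2 → -q < 1 / 2)

/-- The image of `Ω` under `(z, w) ↦ (-1 / z, -1 / w)` up to boundary points, in coordinates. -/
def InSΩ (s t p q : ℝ) : Prop :=
  1 / 2 ≤ s ^ 2 + t ^ 2 ∧ (p < 1 / 2 ∧ -p < 1 / 2 ∧ q < 1 / 2 ∧ -q < 1 / 2) ∧
    ((s - 1) ^ 2 + t ^ 2 < 1 / 2 → p < p ^ 2 + q ^ 2) ∧
    ((s + 1) ^ 2 + t ^ 2 < 1 / 2 → -p < p ^ 2 + q ^ 2) ∧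
    (s ^ 2 + (t - 1) ^ 2 < 1 / 2 → q < p ^ 2 + q ^ 2) ∧
    (s ^ 2 + (t + 1) ^ 2 < 1 / 2 → -q < p ^ 2 + q ^ 2)

/-! ### Disks around lattice points -/

/-- By the parallelogram identity, the squared distances from a point to two centres add up to at
least half the squared distance of the centres, here at least 1. -/
theorem disk_disjoint {s t a b c d : ℝ} (h : 2 ≤ (a - c) ^ 2 + (b - d) ^ 2)
    (h₁ : (s - a) ^ 2 + (t - b) ^ 2 < 1 / 2) : 1 / 2 < (s - c) ^ 2 + (t - d) ^ 2 := by
  nlinarith [sq_nonneg (2 * s - a - c), sq_nonneg (2 * t - b - d)]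

theorem disk_disjoint_zero {s t : ℝ} {n m : ℤ} (h : 2 ≤ n ^ 2 + m ^ 2)
    (h₁ : s ^ 2 + t ^ 2 < 1 / 2) : 1 / 2 < (s + n) ^ 2 + (t + m) ^ 2 := by
  have h' : (2 : ℝ) ≤ (n : ℝ) ^ 2 + (m : ℝ) ^ 2 := by exact_mod_cast h
  have := disk_disjoint (s := s) (t := t) (a := 0) (b := 0) (c := -n) (d := -m)
    (by linarith) (by linarith)
  linarith

/-! ### Symmetries of the coordinate descriptions -/

theorem inV_neg_left {n m : ℤ} {s t : ℝ} : InV (-n) m (-s) t ↔ InV n m s t := by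
  simp only [InV, show (-s) ^ 2 = s ^ 2 by ring, show (-s + 1) ^ 2 = (s - 1) ^ 2 by ring,
    show (-s - 1) ^ 2 = (s + 1) ^ 2 by ring, neg_pos, neg_lt_zero]
  tauto

theorem inV_swap {n m : ℤ} {s t : ℝ} : InV m n t s ↔ InV n m s t := by
  simp only [InV, add_comm]
  tauto

theorem inΩ_neg_left {s t p q : ℝ} : InΩ (-s) t (-p) q ↔ InΩ s t p q := by
  simp only [InΩ, show (-s) ^ 2 = s ^ 2 by ring, show (-s + 1) ^ 2 = (s - 1) ^ 2 by ring,
    show (-s - 1) ^ 2 = (s + 1) ^ 2 by ring, neg_neg, show (-p) ^ 2 = p ^ 2 by ring]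
  tauto

theorem inΩ_swap {s t p q : ℝ} : InΩ t s q p ↔ InΩ s t p q := by
  simp only [InΩ, add_comm]
  tauto

theorem inSΩ_neg_left {s t p q : ℝ} : InSΩ (-s) t (-p) q ↔ InSΩ s t p q := by
  simp only [InSΩ, show (-s) ^ 2 = s ^ 2 by ring, show (-s + 1) ^ 2 = (s - 1) ^ 2 by ring,
    show (-s - 1) ^ 2 = (s + 1) ^ 2 by ring, neg_neg, show (-p) ^ 2 = p ^ 2 by ring]
  tauto

theorem inSΩ_swap {s t p q : ℝ} : InSΩ t s q p ↔ InSΩ s t p q := by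
  simp only [InSΩ, add_comm]
  tauto

/-! ### The translation step -/

/-- Translating by the digit `n (1 + i) + m (1 - i)` matches `InSΩ` over `V(a)` with `InΩ`. -/
def TranslationStep (n m : ℤ) (s t p q : ℝ) : Prop :=
  InV n m s t ∧ InSΩ (s + n) (t + m) p q ↔ InΩ s t (p - n) (q - m)

theorem TranslationStep.neg_left {n m : ℤ} {s t p q : ℝ}
    (h : TranslationStep (-n) m (-s) t (-p) q) : TranslationStep n m s t p q := by
  unfold TranslationStep at *
  rw [inV_neg_left] at h
  rwa [show -s + ((-n : ℤ) : ℝ) = -(s + n) by push_cast; ring,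
    show -p - ((-n : ℤ) : ℝ) = -(p - n) by push_cast; ring, inSΩ_neg_left, inΩ_neg_left] at h

theorem TranslationStep.swap {n m : ℤ} {s t p q : ℝ}
    (h : TranslationStep m n t s q p) : TranslationStep n m s t p q := by
  unfold TranslationStep at *
  rwa [inV_swap, inSΩ_swap, inΩ_swap] at h

/-- Both sides are false. `InV` and `InSΩ` contradict each other on s² + t², and the four closed
disks avoided in `InΩ` cover the open square. -/
theorem translationStep_zero {s t p q : ℝ} (hp : |p| < 1 / 2) (hq : |q| < 1 / 2) :
    TranslationStep 0 0 s t p q := by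
  obtain ⟨p1, p2⟩ := abs_lt.1 hp
  obtain ⟨q1, q2⟩ := abs_lt.1 hq
  simp only [TranslationStep, Int.cast_zero, add_zero, sub_zero]
  constructor
  · rintro ⟨⟨h, -⟩, h', -⟩
    linarith
  · rintro ⟨-, ⟨a, b, c, d⟩, -⟩
    rcases le_total 0 p with hp | hp <;> rcases le_total 0 q with hq | hq <;> nlinarith

/-- For n = 1, translation by -1 carries the disk cut from the fibre over the disk about (1, 0) to
the disk about (-1/2, 0), which is cut from L₁. For n ≥ 2 the translated square misses all four
disks. Conversely, the translated square violates -p < 1/2, so a point of Ω above it must avoid the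
disk about (-1, 0), and that is the condition defining V(a). -/
theorem translationStep_axis {n : ℤ} (hn : 0 < n) {s t p q : ℝ} (hp : |p| < 1 / 2)
    (hq : |q| < 1 / 2) : TranslationStep n 0 s t p q := by
  obtain ⟨p1, p2⟩ := abs_lt.1 hp
  obtain ⟨q1, q2⟩ := abs_lt.1 hq
  have hn1 : (1 : ℝ) ≤ n := by exact_mod_cast hn
  unfold TranslationStep
  simp only [Int.cast_zero, add_zero, sub_zero]
  constructor
  · rintro ⟨⟨h, h1, -⟩, -, -, g, -⟩
    have h1 := h1 hn
    refine ⟨h, ?_, fun _ => by linarith, fun h' => by linarith, fun _ => by linarith,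
      fun _ => by linarith⟩
    have key : n - p < (p - n) ^ 2 + q ^ 2 := by
      rcases (show 1 ≤ n from hn).eq_or_lt with rfl | h2
      · have := g (by push_cast; linarith)
        push_cast
        nlinarith
      · have : (2 : ℝ) ≤ n := by exact_mod_cast h2
        nlinarith
    exact ⟨by nlinarith, by linarith, by linarith, by linarith⟩
  · rintro ⟨h, ⟨-, g, -⟩, -, h0, -⟩
    have h1 : 1 / 2 ≤ (s + 1) ^ 2 + t ^ 2 := by
      by_contra hc
      have := h0 (not_le.1 hc)
      linarith
    have far : ∀ k l : ℤ, 2 ≤ k ^ 2 + l ^ 2 → 1 / 2 < (s + k) ^ 2 + (t + l) ^ 2 :=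
      fun k l hk => disk_disjoint_zero hk h
    refine ⟨⟨h, fun _ => h1, fun h => by omega, fun h => by omega, fun h => by omega⟩, ?_,
      ⟨p2, by linarith, q2, by linarith⟩, ?_, fun h' => ?_, fun h' => ?_, fun h' => ?_⟩
    · rcases (show 1 ≤ n from hn).eq_or_lt with rfl | h2
      · simpa using h1
      · simpa using (far n 0 (by nlinarith)).le
    · intro h'
      -- Relative to s, the disk in `h'` is centred at (1 - n, 0): the central disk for n = 1, the
      -- disk excluded by `h1` for n = 2, and disjoint from the central disk for n ≥ 3.
      obtain rfl | rfl | h3 : n = 1 ∨ n = 2 ∨ 3 ≤ n := by omega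
      · push_cast at g
        nlinarith
      · push_cast at h'
        linarith
      · have := far (n - 1) 0 (by nlinarith)
        push_cast at this
        linarith
    · have := far (n + 1) 0 (by nlinarith)
      push_cast at this
      linarith
    · have := far n (-1) (by nlinarith)
      push_cast at this
      linarith
    · have := far n 1 (by nlinarith)
      push_cast at this
      linarith

/-- The translated square lies in p, q < -1/2, outside all four disks, so over it Ω only requires
(s, t) to avoid the disks about (-1, 0) and (0, -1), as V(a) does. No fibre of SΩ over a + V(a) is
cut: the disk about (1, 0) pulls back to the one about (1 - n, -m), which V(a) excludes when n = m =
1 and which misses the central disk otherwise. -/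
theorem translationStep_quadrant {n m : ℤ} (hn : 0 < n) (hm : 0 < m) {s t p q : ℝ}
    (hp : |p| < 1 / 2) (hq : |q| < 1 / 2) : TranslationStep n m s t p q := by
  obtain ⟨p1, p2⟩ := abs_lt.1 hp
  obtain ⟨q1, q2⟩ := abs_lt.1 hq
  have hn1 : (1 : ℝ) ≤ n := by exact_mod_cast hn
  have hm1 : (1 : ℝ) ≤ m := by exact_mod_cast hm
  unfold TranslationStep
  constructor
  · rintro ⟨⟨h, h1, -, h2, -⟩, -⟩
    have h1 := h1 hn
    have h2 := h2 hm
    refine ⟨h, ⟨by nlinarith, by nlinarith, by nlinarith, by nlinarith⟩, fun _ => by linarith,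
      fun h' => by linarith, fun _ => by linarith, fun h' => by linarith⟩
  · rintro ⟨h, -, -, h1, -, h2⟩
    have h1 : 1 / 2 ≤ (s + 1) ^ 2 + t ^ 2 := by
      by_contra hc
      have := h1 (not_le.1 hc)
      linarith
    have h2 : 1 / 2 ≤ s ^ 2 + (t + 1) ^ 2 := by
      by_contra hc
      have := h2 (not_le.1 hc)
      linarith
    have far : ∀ k l : ℤ, 2 ≤ k ^ 2 + l ^ 2 → 1 / 2 < (s + k) ^ 2 + (t + l) ^ 2 :=
      fun k l hk => disk_disjoint_zero hk h
    refine ⟨⟨h, fun _ => h1, fun h => by omega, fun _ => h2, fun h => by omega⟩,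
      (far n m (by nlinarith)).le,
      ⟨p2, by linarith, q2, by linarith⟩, fun h' => ?_, fun h' => ?_, fun h' => ?_, fun h' => ?_⟩
    · exfalso
      by_cases e : n = 1 ∧ m = 1
      · obtain ⟨rfl, rfl⟩ := e
        push_cast at h'
        linarith
      · have : 2 ≤ (n - 1) ^ 2 + m ^ 2 := by
          obtain h3 | h3 : 2 ≤ n ∨ 2 ≤ m := by omega
          · nlinarith
          · nlinarith [sq_nonneg (n - 1)]
        have := far (n - 1) m this
        push_cast at this
        linarith
    · have := far (n + 1) m (by nlinarith)
      push_cast at this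
      linarith
    · exfalso
      by_cases e : n = 1 ∧ m = 1
      · obtain ⟨rfl, rfl⟩ := e
        push_cast at h'
        linarith
      · have : 2 ≤ n ^ 2 + (m - 1) ^ 2 := by
          obtain h3 | h3 : 2 ≤ n ∨ 2 ≤ m := by omega
          · nlinarith [sq_nonneg (m - 1)]
          · nlinarith
        have := far n (m - 1) this
        push_cast at this
        linarith
    · have := far n (m + 1) (by nlinarith)
      push_cast at this
      linarith

theorem translationStep (n m : ℤ) {s t p q : ℝ} (hp : |p| < 1 / 2) (hq : |q| < 1 / 2) :
    TranslationStep n m s t p q := by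
  have nonneg : ∀ (n m : ℤ), 0 ≤ n → 0 ≤ m → ∀ s t p q : ℝ, |p| < 1 / 2 → |q| < 1 / 2 →
      TranslationStep n m s t p q := by
    intro n m hn hm s t p q hp hq
    rcases hn.eq_or_lt with rfl | hn <;> rcases hm.eq_or_lt with rfl | hm
    · exact translationStep_zero hp hq
    · exact (translationStep_axis hm hq hp).swap
    · exact translationStep_axis hn hp hq
    · exact translationStep_quadrant hn hm hp hq
  have right_nonneg : ∀ (n m : ℤ), 0 ≤ m → ∀ s t p q : ℝ, |p| < 1 / 2 → |q| < 1 / 2 →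
      TranslationStep n m s t p q := by
    intro n m hm s t p q hp hq
    rcases le_total 0 n with hn | hn
    · exact nonneg n m hn hm _ _ _ _ hp hq
    · exact (nonneg (-n) m (by omega) hm _ _ _ _ (by rwa [abs_neg]) hq).neg_left
  rcases le_total 0 m with hm | hm
  · exact right_nonneg n m hm _ _ _ _ hp hq
  -- Conjugating the reflection of the first coordinate by the swap reflects the second.
  · refine TranslationStep.swap (TranslationStep.neg_left (TranslationStep.swap ?_))
    exact right_nonneg n (-m) (by omega) _ _ _ _ hp (by rwa [abs_neg])

/-- The sets `a + V(a)` overlap only in boundary points. -/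
theorem InV.digit_unique {n m k l : ℤ} {s t : ℝ}
    (h : InV n m (s - n) (t - m)) (h' : InV k l (s - k) (t - l)) : n = k ∧ m = l := by
  -- Two disks share a point, so their centres are equal or adjacent in the lattice.
  have close : (n - k) ^ 2 + (m - l) ^ 2 < 2 := by
    by_contra hc
    have := disk_disjoint_zero (not_lt.1 hc) h.1
    push_cast at this
    have := h'.1
    nlinarith
  obtain ⟨h0, h1, h2, h3, h4⟩ := h
  obtain ⟨g0, g1, g2, g3, g4⟩ := h'
  have cases : (n = k ∧ m = l) ∨ (k = n + 1 ∧ m = l) ∨ (n = k + 1 ∧ m = l) ∨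
      (n = k ∧ l = m + 1) ∨ (n = k ∧ m = l + 1) := by
    have a1 : -1 ≤ n - k := by nlinarith [sq_nonneg (m - l)]
    have a2 : n - k ≤ 1 := by nlinarith [sq_nonneg (m - l)]
    have a3 : -1 ≤ m - l := by nlinarith [sq_nonneg (n - k)]
    have a4 : m - l ≤ 1 := by nlinarith [sq_nonneg (n - k)]
    generalize hx : n - k = x at *
    generalize hy : m - l = y at *
    interval_cases x <;> interval_cases y <;> omega
  rcases cases with h | ⟨rfl, rfl⟩ | ⟨rfl, rfl⟩ | ⟨rfl, rfl⟩ | ⟨rfl, rfl⟩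
  · exact h
  -- Of two adjacent digits, the one farther from 0 gives up the overlap.
  all_goals
    exfalso
    push_cast at *
  · rcases le_or_gt 0 n with hn | hn
    · linarith [g1 (by omega)]
    · linarith [h2 hn]
  · rcases le_or_gt 0 k with hn | hn
    · linarith [h1 (by omega)]
    · linarith [g2 hn]
  · rcases le_or_gt 0 m with hn | hn
    · linarith [g3 (by omega)]
    · linarith [h4 hn]
  · rcases le_or_gt 0 l with hn | hn
    · linarith [h3 (by omega)]
    · linarith [g4 hn]

/-! ### The inversion step -/

/-- S is inversion in the unit circle followed by a reflection. The unit circles about ±1 ± i are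
orthogonal to the unit circle, so S permutes their disks. The circles p² + q² = ±p, ±q pass through
0, so S exchanges them with the lines bounding the square. The coordinates swap because conjugation
exchanges 1 + i and 1 - i. -/
theorem inΩ_iff_inSΩ {s t p q : ℝ} (hst : s ^ 2 + t ^ 2 ≠ 0) (hpq : p ^ 2 + q ^ 2 ≠ 0)
    (hne : s ^ 2 + t ^ 2 ≠ 1 / 2) :
    InΩ s t p q ↔ InSΩ (-t / (2 * (s ^ 2 + t ^ 2))) (-s / (2 * (s ^ 2 + t ^ 2)))
      (-q / (2 * (p ^ 2 + q ^ 2))) (-p / (2 * (p ^ 2 + q ^ 2))) := by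
  have norm_inv : ∀ {s t : ℝ}, s ^ 2 + t ^ 2 ≠ 0 →
      (-t / (2 * (s ^ 2 + t ^ 2))) ^ 2 + (-s / (2 * (s ^ 2 + t ^ 2))) ^ 2 =
        1 / (4 * (s ^ 2 + t ^ 2)) := by
    intro s t h
    field_simp
    ring
  have pos : ∀ {s t : ℝ}, s ^ 2 + t ^ 2 ≠ 0 → 0 < s ^ 2 + t ^ 2 := fun h =>
    lt_of_le_of_ne (by positivity) h.symm
  have hR := pos hst
  have hP := pos hpq
  have disk : ∀ x ε : ℝ, (-x / (2 * (s ^ 2 + t ^ 2)) * (-2 * ε) +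
      1 / (4 * (s ^ 2 + t ^ 2)) + 1 < 1 / 2 ↔ s ^ 2 + t ^ 2 + 2 * ε * x + 1 < 1 / 2) := by
    intro x ε
    rw [← sub_neg, ← sub_neg (b := (1 / 2 : ℝ)),
      show -x / (2 * (s ^ 2 + t ^ 2)) * (-2 * ε) + 1 / (4 * (s ^ 2 + t ^ 2)) + 1 - 1 / 2 =
        (s ^ 2 + t ^ 2 + 2 * ε * x + 1 - 1 / 2) / (2 * (s ^ 2 + t ^ 2)) by field_simp; ring,
      div_neg_iff]
    constructor
    · rintro (⟨-, h⟩ | ⟨h, -⟩)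
      · linarith
      · exact h
    · exact fun h => Or.inr ⟨h, by linarith⟩
  have half : ∀ x : ℝ, -x / (2 * (p ^ 2 + q ^ 2)) < 1 / 2 ↔ -x < p ^ 2 + q ^ 2 := by
    intro x
    rw [div_lt_iff₀ (by linarith)]
    constructor <;> intro h <;> linarith
  have half' : ∀ x : ℝ, -(-x / (2 * (p ^ 2 + q ^ 2))) < 1 / 2 ↔ x < p ^ 2 + q ^ 2 := by
    intro x
    rw [← neg_div, div_lt_iff₀ (by linarith)]
    constructor <;> intro h <;> linarith
  have ball : ∀ x : ℝ, -x / (2 * (p ^ 2 + q ^ 2)) < 1 / (4 * (p ^ 2 + q ^ 2)) ↔ -x < 1 / 2 := by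
    intro x
    rw [div_lt_div_iff₀ (by linarith) (by linarith)]
    constructor <;> intro h <;> nlinarith
  have ball' : ∀ x : ℝ,
      -(-x / (2 * (p ^ 2 + q ^ 2))) < 1 / (4 * (p ^ 2 + q ^ 2)) ↔ x < 1 / 2 := by
    intro x
    rw [← neg_div, div_lt_div_iff₀ (by linarith) (by linarith)]
    constructor <;> intro h <;> nlinarith
  have outside : 1 / 2 ≤ 1 / (4 * (s ^ 2 + t ^ 2)) ↔ s ^ 2 + t ^ 2 < 1 / 2 := by
    rw [div_le_div_iff₀ (by norm_num) (by linarith)]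
    constructor
    · intro h
      exact lt_of_le_of_ne (by linarith) hne
    · intro h
      linarith
  have add_one : ∀ {s t : ℝ}, (s + 1) ^ 2 + t ^ 2 = s ^ 2 + t ^ 2 + 2 * 1 * s + 1 ∧
      (s - 1) ^ 2 + t ^ 2 = s ^ 2 + t ^ 2 + 2 * (-1) * s + 1 ∧
      s ^ 2 + (t + 1) ^ 2 = s ^ 2 + t ^ 2 + 2 * 1 * t + 1 ∧
      s ^ 2 + (t - 1) ^ 2 = s ^ 2 + t ^ 2 + 2 * (-1) * t + 1 := by
    intro s t
    refine ⟨by ring, by ring, by ring, by ring⟩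
  have inv_add : ∀ x ε : ℝ, 1 / (4 * (s ^ 2 + t ^ 2)) + 2 * ε * (-x / (2 * (s ^ 2 + t ^ 2))) + 1 =
      -x / (2 * (s ^ 2 + t ^ 2)) * (-2 * -ε) + 1 / (4 * (s ^ 2 + t ^ 2)) + 1 := by
    intro x ε
    ring
  simp only [InΩ, InSΩ, add_one.1, add_one.2.1, add_one.2.2.1, add_one.2.2.2, norm_inv hst,
    norm_inv hpq, inv_add, disk _ (-1), disk _ 1, half,
    half', ball, ball', outside, neg_neg]
  tauto

/-! ### Genericity -/

theorem Generic.inv {s t : ℝ} (h : Generic s t) (hst : s ^ 2 + t ^ 2 ≠ 0) :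
    Generic (-t / (2 * (s ^ 2 + t ^ 2))) (-s / (2 * (s ^ 2 + t ^ 2))) := by
  intro a b c d e
  -- Multiplying the equation by 4(s² + t²) gives an integer equation with the roles of a and d, and
  -- of b and c, exchanged.
  have : ((4 * d : ℤ) : ℝ) * (s ^ 2 + t ^ 2) + ((-2 * c : ℤ) : ℝ) * s + ((-2 * b : ℤ) : ℝ) * t +
      a = 0 := by
    push_cast
    field_simp at e
    rw [show (t ^ 2 + s ^ 2 : ℝ) = s ^ 2 + t ^ 2 by ring] at e
    have h2 : (s ^ 2 + t ^ 2) * (4 * d * (s ^ 2 + t ^ 2) + -2 * c * s + -2 * b * t + a) = 0 := by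
      linarith
    exact (mul_eq_zero.1 h2).resolve_left hst
  have := h _ _ _ _ this
  omega

theorem Generic.add_int {s t : ℝ} (h : Generic s t) (n m : ℤ) : Generic (s + n) (t + m) := by
  intro a b c d e
  have : (a : ℝ) * (s ^ 2 + t ^ 2) + ((b + 2 * a * n : ℤ) : ℝ) * s +
      ((c + 2 * a * m : ℤ) : ℝ) * t +
      ((d + a * (n ^ 2 + m ^ 2) + b * n + c * m : ℤ) : ℝ) = 0 := by
    push_cast
    linarith
  obtain ⟨rfl, h2, h3, h4⟩ := h _ _ _ _ this
  simp at h2 h3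
  subst h2 h3
  simpa using h4

theorem Generic.sq_add_sq_ne_zero {s t : ℝ} (h : Generic s t) : s ^ 2 + t ^ 2 ≠ 0 := by
  intro e
  simpa using h 1 0 0 0 (by push_cast; linarith)

theorem Generic.sq_add_sq_ne_half {s t : ℝ} (h : Generic s t) : s ^ 2 + t ^ 2 ≠ 1 / 2 := by
  intro e
  simpa using h 2 0 0 (-1) (by push_cast; linarith)

/-- Translation by an integer brings a generic coordinate strictly within `1 / 2` of `0`. -/
theorem Generic.exists_digit {s t : ℝ} (h : Generic s t) :
    ∃ n m : ℤ, |s + n| < 1 / 2 ∧ |t + m| < 1 / 2 := by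
  have aux : ∀ x : ℝ, (∀ k : ℤ, 2 * x + k ≠ 0) → ∃ n : ℤ, |x + n| < 1 / 2 := by
    intro x hx
    refine ⟨-round x, ?_⟩
    have := abs_sub_round x
    push_cast
    rw [← sub_eq_add_neg]
    refine lt_of_le_of_ne this fun e => ?_
    rcases (abs_eq (by norm_num)).1 e with e | e
    · exact hx (-2 * round x - 1) (by push_cast; linarith)
    · exact hx (-2 * round x + 1) (by push_cast; linarith)
  obtain ⟨n, hn⟩ := aux s fun k e => by
    simpa using h 0 2 0 k (by push_cast; linarith)
  obtain ⟨m, hm⟩ := aux t fun k e => by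
    simpa using h 0 0 2 k (by push_cast; linarith)
  exact ⟨n, m, hn, hm⟩

/-! ### Complex numbers in coordinates -/

theorem sq_norm_eq (z : ℂ) : ‖z‖ ^ 2 = 2 * (sc z ^ 2 + tc z ^ 2) := by
  rw [← Complex.normSq_eq_norm_sq, Complex.normSq_apply, sc, tc]
  ring

theorem norm_le_one_iff (z : ℂ) : ‖z‖ ≤ 1 ↔ sc z ^ 2 + tc z ^ 2 ≤ 1 / 2 := by
  rw [← sq_le_one_iff₀ (norm_nonneg _), sq_norm_eq]
  constructor <;> intro h <;> linarith

theorem one_le_norm_iff (z : ℂ) : 1 ≤ ‖z‖ ↔ 1 / 2 ≤ sc z ^ 2 + tc z ^ 2 := by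
  rw [← one_le_sq_iff₀ (norm_nonneg _), sq_norm_eq]
  constructor <;> intro h <;> linarith

@[simp] theorem sc_add (z w : ℂ) : sc (z + w) = sc z + sc w := by simp [sc]; ring
@[simp] theorem tc_add (z w : ℂ) : tc (z + w) = tc z + tc w := by simp [tc]; ring
@[simp] theorem sc_sub (z w : ℂ) : sc (z - w) = sc z - sc w := by simp [sc]; ring
@[simp] theorem tc_sub (z w : ℂ) : tc (z - w) = tc z - tc w := by simp [tc]; ring
@[simp] theorem sc_neg (z : ℂ) : sc (-z) = -sc z := by simp [sc]; ring
@[simp] theorem tc_neg (z : ℂ) : tc (-z) = -tc z := by simp [tc]; ring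
@[simp] theorem sc_one : sc 1 = 1 / 2 := by simp [sc]
@[simp] theorem tc_one : tc 1 = 1 / 2 := by simp [tc]
@[simp] theorem sc_I : sc Complex.I = 1 / 2 := by simp [sc]
@[simp] theorem tc_I : tc Complex.I = -(1 / 2) := by simp [tc]; ring
@[simp] theorem sc_I_mul (z : ℂ) : sc (Complex.I * z) = tc z := by simp [sc, tc]; ring
@[simp] theorem tc_I_mul (z : ℂ) : tc (Complex.I * z) = -sc z := by simp [sc, tc]; ring
@[simp] theorem sc_div_two (z : ℂ) : sc (z / 2) = sc z / 2 := by simp [sc]; ring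
@[simp] theorem tc_div_two (z : ℂ) : tc (z / 2) = tc z / 2 := by simp [tc]; ring

@[simp] theorem sc_gaussian (n m : ℤ) : sc ((⟨n + m, n - m⟩ : GaussianInt) : ℂ) = n := by
  simp [sc, GaussianInt.toComplex_def]

@[simp] theorem tc_gaussian (n m : ℤ) : tc ((⟨n + m, n - m⟩ : GaussianInt) : ℂ) = m := by
  simp [tc, GaussianInt.toComplex_def]

theorem coords_sq_add_sq (z : ℂ) : sc z ^ 2 + tc z ^ 2 = (z.re ^ 2 + z.im ^ 2) / 2 := by
  simp only [sc, tc]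
  ring

theorem sc_neg_one_div (z : ℂ) : sc (-1 / z) = -tc z / (2 * (sc z ^ 2 + tc z ^ 2)) := by
  rw [coords_sq_add_sq, neg_div, one_div, sc_neg, sc, tc, Complex.inv_re, Complex.inv_im,
    Complex.normSq_apply]
  ring_nf

theorem tc_neg_one_div (z : ℂ) : tc (-1 / z) = -sc z / (2 * (sc z ^ 2 + tc z ^ 2)) := by
  rw [coords_sq_add_sq, neg_div, one_div, tc_neg, sc, tc, Complex.inv_re, Complex.inv_im,
    Complex.normSq_apply]
  ring_nf

/-! ### The choice function in coordinates -/

theorem exists_of_mem_E (a : GaussianInt) :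
    (a ∈ E 0 → ∃ n m : ℤ, a = ⟨n + m, n - m⟩ ∧ n = 0 ∧ m = 0) ∧
    (a ∈ E 1 → ∃ n m : ℤ, a = ⟨n + m, n - m⟩ ∧ 0 < n ∧ m = 0) ∧
    (a ∈ E 2 → ∃ n m : ℤ, a = ⟨n + m, n - m⟩ ∧ n = 0 ∧ 0 < m) ∧
    (a ∈ E 3 → ∃ n m : ℤ, a = ⟨n + m, n - m⟩ ∧ n < 0 ∧ m = 0) ∧
    (a ∈ E 4 → ∃ n m : ℤ, a = ⟨n + m, n - m⟩ ∧ n = 0 ∧ m < 0) ∧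
    (a ∈ E 5 → ∃ n m : ℤ, a = ⟨n + m, n - m⟩ ∧ 0 < n ∧ 0 < m) ∧
    (a ∈ E 6 → ∃ n m : ℤ, a = ⟨n + m, n - m⟩ ∧ n < 0 ∧ 0 < m) ∧
    (a ∈ E 7 → ∃ n m : ℤ, a = ⟨n + m, n - m⟩ ∧ n < 0 ∧ m < 0) ∧
    (a ∈ E 8 → ∃ n m : ℤ, a = ⟨n + m, n - m⟩ ∧ 0 < n ∧ m < 0) := by
  have h0 : ∀ a ∈ E 0, ∃ n m : ℤ, a = ⟨n + m, n - m⟩ ∧ n = 0 ∧ m = 0 := by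
    intro a h
    rw [E] at h
    exact ⟨0, 0, h, rfl, rfl⟩
  have h1 : ∀ a ∈ E 1, ∃ n m : ℤ, a = ⟨n + m, n - m⟩ ∧ 0 < n ∧ m = 0 := by
    intro a h
    rw [E] at h
    obtain ⟨n, hn, rfl⟩ := h
    exact ⟨n, 0, by ext <;> simp [α], hn, rfl⟩
  have h5 : ∀ a ∈ E 5, ∃ n m : ℤ, a = ⟨n + m, n - m⟩ ∧ 0 < n ∧ 0 < m := by
    intro a h
    rw [E] at h
    obtain ⟨n, m, hn, hm, rfl⟩ := h
    exact ⟨n, m, by ext <;> simp [α, αbar, sub_eq_add_neg], hn, hm⟩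
  have st : ∀ (j : ℕ) (P Q : ℤ → Prop), E (j + 1) = (fun a : GaussianInt => -gI * a) '' E j →
      (∀ a ∈ E j, ∃ n m : ℤ, a = ⟨n + m, n - m⟩ ∧ P n ∧ Q m) →
      ∀ a ∈ E (j + 1), ∃ n m : ℤ, a = ⟨n + m, n - m⟩ ∧ Q (-n) ∧ P m := by
    intro j P Q h hj a ha
    rw [h] at ha
    obtain ⟨b, hb, rfl⟩ := ha
    obtain ⟨n, m, rfl, hP, hQ⟩ := hj b hb
    -- Multiplication by -i acts on coordinates as (n, m) ↦ (-m, n).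
    exact ⟨-m, n, by ext <;> simp [gI] <;> ring, by rwa [neg_neg], hP⟩
  have h2 := st 1 (0 < ·) (· = 0) (by simp [E]) h1
  have h3 := st 2 (- · = 0) (0 < ·) (by simp [E]) h2
  have h4 := st 3 (0 < - ·) (- · = 0) (by simp [E]) h3
  have h6 := st 5 (0 < ·) (0 < ·) (by simp [E]) h5
  have h7 := st 6 (0 < - ·) (0 < ·) (by simp [E]) h6
  have h8 := st 7 (0 < - ·) (0 < - ·) (by simp [E]) h7
  simp only [neg_eq_zero, Int.neg_pos, neg_neg] at h2 h3 h4 h6 h7 h8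
  exact ⟨h0 a, h1 a, h2 a, h3 a, h4 a, h5 a, h6 a, h7 a, h8 a⟩

theorem Generic.sub_int {s t : ℝ} (h : Generic s t) (n m : ℤ) : Generic (s - n) (t - m) := by
  simpa [sub_eq_add_neg] using h.add_int (-n) (-m)

/-- The nine cases become sign conditions on n and m. Genericity makes the disk inequality strict,
so tie-breaking plays no role. -/
theorem IsDiskChoice.exists_inV {c : ℂ → GaussianInt} (hc : IsDiskChoice c) {u : ℂ}
    (hu : Generic (sc u) (tc u)) :
    ∃ n m : ℤ, c u = ⟨n + m, n - m⟩ ∧ InV n m (sc u - n) (tc u - m) := by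
  have hu0 : u ≠ 0 := by
    rintro rfl
    exact hu.sq_add_sq_ne_zero (by simp [sc, tc])
  obtain ⟨j, hj, hE, hV⟩ := hc u hu0
  obtain ⟨e0, e1, e2, e3, e4, e5, e6, e7, e8⟩ := exists_of_mem_E (c u)
  obtain ⟨v0, v1, v2, v3, v4, v5, v6, v7, v8⟩ := mem_V_iff (u - c u)
  have key : ∀ n m : ℤ, c u = ⟨n + m, n - m⟩ → ‖u - c u‖ ≤ 1 →
      (0 < n → 1 ≤ ‖u - c u + (1 + Complex.I)‖) → (n < 0 → 1 ≤ ‖u - c u - (1 + Complex.I)‖) →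
      (0 < m → 1 ≤ ‖u - c u + (1 - Complex.I)‖) → (m < 0 → 1 ≤ ‖u - c u - (1 - Complex.I)‖) →
      ∃ n m : ℤ, c u = ⟨n + m, n - m⟩ ∧ InV n m (sc u - n) (tc u - m) := by
    intro n m e h h1 h2 h3 h4
    have hne := (hu.sub_int n m).sq_add_sq_ne_half
    rw [e] at h h1 h2 h3 h4
    simp only [norm_le_one_iff, one_le_norm_iff, sc_add, sc_sub, tc_add, tc_sub, sc_gaussian,
      tc_gaussian, sc_one, sc_I, tc_one, tc_I, add_halves, add_neg_cancel, sub_self,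
      sub_neg_eq_add, add_zero, sub_zero] at h h1 h2 h3 h4
    exact ⟨n, m, e, lt_of_le_of_ne h hne, h1, h2, h3, h4⟩
  interval_cases j
  · obtain ⟨n, m, e, hn, hm⟩ := e0 hE
    obtain h := v0.1 hV
    refine key n m e h ?_ ?_ ?_ ?_ <;> intro h' <;> first | assumption | omega
  · obtain ⟨n, m, e, hn, hm⟩ := e1 hE
    obtain ⟨h, h1⟩ := v1.1 hV
    refine key n m e h ?_ ?_ ?_ ?_ <;> intro h' <;> first | assumption | omega
  · obtain ⟨n, m, e, hn, hm⟩ := e2 hE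
    obtain ⟨h, h1⟩ := v2.1 hV
    refine key n m e h ?_ ?_ ?_ ?_ <;> intro h' <;> first | assumption | omega
  · obtain ⟨n, m, e, hn, hm⟩ := e3 hE
    obtain ⟨h, h1⟩ := v3.1 hV
    refine key n m e h ?_ ?_ ?_ ?_ <;> intro h' <;> first | assumption | omega
  · obtain ⟨n, m, e, hn, hm⟩ := e4 hE
    obtain ⟨h, h1⟩ := v4.1 hV
    refine key n m e h ?_ ?_ ?_ ?_ <;> intro h' <;> first | assumption | omega
  · obtain ⟨n, m, e, hn, hm⟩ := e5 hE
    obtain ⟨h, h1, h2⟩ := v5.1 hV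
    refine key n m e h ?_ ?_ ?_ ?_ <;> intro h' <;> first | assumption | omega
  · obtain ⟨n, m, e, hn, hm⟩ := e6 hE
    obtain ⟨h, h1, h2⟩ := v6.1 hV
    refine key n m e h ?_ ?_ ?_ ?_ <;> intro h' <;> first | assumption | omega
  · obtain ⟨n, m, e, hn, hm⟩ := e7 hE
    obtain ⟨h, h1, h2⟩ := v7.1 hV
    refine key n m e h ?_ ?_ ?_ ?_ <;> intro h' <;> first | assumption | omega
  · obtain ⟨n, m, e, hn, hm⟩ := e8 hE
    obtain ⟨h, h1, h2⟩ := v8.1 hV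
    refine key n m e h ?_ ?_ ?_ ?_ <;> intro h' <;> first | assumption | omega

/-! ### The domain in coordinates -/

theorem mem_image_rot_iff (A : Set ℂ) (z : ℂ) :
    z ∈ (fun w : ℂ => -Complex.I * w) '' A ↔ Complex.I * z ∈ A := by
  constructor
  · rintro ⟨y, hy, rfl⟩
    rwa [← mul_assoc, mul_neg, Complex.I_mul_I, neg_neg, one_mul]
  · intro h
    exact ⟨_, h, by simp [← mul_assoc]⟩

theorem coe_mem_image_rot_iff (A : Set (OnePoint ℂ)) (w : ℂ) :
    (w : OnePoint ℂ) ∈ rot '' A ↔ ((Complex.I * w : ℂ) : OnePoint ℂ) ∈ A := by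
  constructor
  · rintro ⟨y, hy, h⟩
    induction y using OnePoint.rec with
    | infty => simp [rot] at h
    | coe y =>
      simp only [rot, OnePoint.map_some, OnePoint.coe_eq_coe] at h
      rwa [← h, ← mul_assoc, mul_neg, Complex.I_mul_I, neg_neg, one_mul]
  · intro h
    exact ⟨_, h, by simp [rot, ← mul_assoc]⟩

theorem coe_mem_B_iff (w c : ℂ) :
    (w : OnePoint ℂ) ∈ B c ↔ (sc w - sc c) ^ 2 + (tc w - tc c) ^ 2 < 1 / 4 := by
  have : (w : OnePoint ℂ) ∈ B c ↔ ‖w - c‖ < 1 / Real.sqrt 2 := by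
    simp [B, dist_eq_norm]
  rw [this, ← sq_lt_sq₀ (norm_nonneg _) (by positivity), sq_norm_eq, sc_sub, tc_sub, div_pow,
    Real.sq_sqrt (by norm_num)]
  constructor <;> intro h <;> linarith

theorem coe_mem_L₁_iff (w : ℂ) : (w : OnePoint ℂ) ∈ L₁ ↔
    sc w ≤ sc w ^ 2 + tc w ^ 2 ∧ -sc w ≤ sc w ^ 2 + tc w ^ 2 ∧
      tc w ≤ sc w ^ 2 + tc w ^ 2 ∧ -tc w ≤ sc w ^ 2 + tc w ^ 2 := by
  simp only [L₁, Set.mem_sdiff, Set.mem_univ, true_and, Set.mem_union, coe_mem_B_iff, not_or,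
    not_lt, sc_div_two, tc_div_two, sc_add, tc_add, sc_sub, tc_sub, sc_neg, tc_neg, sc_one, tc_one,
    sc_I, tc_I]
  constructor
  · rintro ⟨⟨⟨h1, h2⟩, h3⟩, h4⟩
    refine ⟨?_, ?_, ?_, ?_⟩ <;> linarith
  · rintro ⟨h1, h2, h3, h4⟩
    refine ⟨⟨⟨?_, ?_⟩, ?_⟩, ?_⟩ <;> linarith

theorem coe_mem_L₂_iff (w : ℂ) :
    (w : OnePoint ℂ) ∈ L₂ ↔ (w : OnePoint ℂ) ∈ L₁ ∧ -tc w ≤ 1 / 2 := by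
  have : w.im > w.re + 1 ↔ ¬ -tc w ≤ 1 / 2 := by
    rw [tc, not_le]
    constructor <;> intro h <;> linarith
  simp only [L₂, Set.mem_sdiff, Set.mem_image, Set.mem_ofPred_eq, OnePoint.coe_eq_coe,
    exists_eq_right, this, not_not]

theorem coe_I_mul_mem_L₁_iff (w : ℂ) :
    ((Complex.I * w : ℂ) : OnePoint ℂ) ∈ L₁ ↔ (w : OnePoint ℂ) ∈ L₁ := by
  simp only [coe_mem_L₁_iff, sc_I_mul, tc_I_mul, neg_neg, neg_sq, add_comm (tc w ^ 2)]
  tauto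

theorem coe_mem_L₃_iff (w : ℂ) :
    (w : OnePoint ℂ) ∈ L₃ ↔ (w : OnePoint ℂ) ∈ L₁ ∧ sc w ≤ 1 / 2 := by
  rw [L₃, coe_mem_image_rot_iff, coe_mem_L₂_iff, coe_I_mul_mem_L₁_iff, tc_I_mul, neg_neg]

theorem coe_mem_L₄_iff (w : ℂ) :
    (w : OnePoint ℂ) ∈ L₄ ↔ (w : OnePoint ℂ) ∈ L₁ ∧ tc w ≤ 1 / 2 := by
  rw [L₄, coe_mem_image_rot_iff, coe_mem_L₃_iff, coe_I_mul_mem_L₁_iff, sc_I_mul]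

theorem coe_mem_L₅_iff (w : ℂ) :
    (w : OnePoint ℂ) ∈ L₅ ↔ (w : OnePoint ℂ) ∈ L₁ ∧ -sc w ≤ 1 / 2 := by
  rw [L₅, coe_mem_image_rot_iff, coe_mem_L₄_iff, coe_I_mul_mem_L₁_iff, tc_I_mul]

theorem mem_K₂_iff (z : ℂ) : z ∈ K₂ ↔
    sc z ^ 2 + tc z ^ 2 ≤ 1 / 2 ∧ sc z ^ 2 + (tc z + 1) ^ 2 ≤ 1 / 2 := by
  simp only [K₂, Set.mem_ofPred_eq, mem_closedBall_zero_iff, norm_le_one_iff, sc_sub, tc_sub,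
    sc_add, tc_add, sc_neg, tc_neg, sc_one, tc_one, sc_I, tc_I]
  ring_nf

theorem mem_K₃_iff (z : ℂ) : z ∈ K₃ ↔
    sc z ^ 2 + tc z ^ 2 ≤ 1 / 2 ∧ (sc z - 1) ^ 2 + tc z ^ 2 ≤ 1 / 2 := by
  rw [K₃, mem_image_rot_iff, mem_K₂_iff, sc_I_mul, tc_I_mul]
  ring_nf

theorem mem_K₄_iff (z : ℂ) : z ∈ K₄ ↔
    sc z ^ 2 + tc z ^ 2 ≤ 1 / 2 ∧ sc z ^ 2 + (tc z - 1) ^ 2 ≤ 1 / 2 := by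
  rw [K₄, mem_image_rot_iff, mem_K₃_iff, sc_I_mul, tc_I_mul]
  ring_nf

theorem mem_K₅_iff (z : ℂ) : z ∈ K₅ ↔
    sc z ^ 2 + tc z ^ 2 ≤ 1 / 2 ∧ (sc z + 1) ^ 2 + tc z ^ 2 ≤ 1 / 2 := by
  rw [K₅, mem_image_rot_iff, mem_K₄_iff, sc_I_mul, tc_I_mul]
  ring_nf

theorem mem_K₁_iff (z : ℂ) : z ∈ K₁ ↔ sc z ^ 2 + tc z ^ 2 ≤ 1 / 2 ∧
    z ∉ K₂ ∧ z ∉ K₃ ∧ z ∉ K₄ ∧ z ∉ K₅ := by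
  simp only [K₁, Set.mem_sdiff, mem_closedBall_zero_iff, norm_le_one_iff, Set.mem_union, not_or]
  tauto

theorem Generic.strict {s t : ℝ} (h : Generic s t) :
    (s ≤ s ^ 2 + t ^ 2 ↔ s < s ^ 2 + t ^ 2) ∧ (-s ≤ s ^ 2 + t ^ 2 ↔ -s < s ^ 2 + t ^ 2) ∧
    (t ≤ s ^ 2 + t ^ 2 ↔ t < s ^ 2 + t ^ 2) ∧ (-t ≤ s ^ 2 + t ^ 2 ↔ -t < s ^ 2 + t ^ 2) ∧
    (s ≤ 1 / 2 ↔ s < 1 / 2) ∧ (-s ≤ 1 / 2 ↔ -s < 1 / 2) ∧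
    (t ≤ 1 / 2 ↔ t < 1 / 2) ∧ (-t ≤ 1 / 2 ↔ -t < 1 / 2) := by
  have aux : ∀ {x y : ℝ} (a b c d : ℤ), ¬ (a = 0 ∧ b = 0 ∧ c = 0 ∧ d = 0) →
      (x = y → a * (s ^ 2 + t ^ 2) + b * s + c * t + d = 0) → (x ≤ y ↔ x < y) :=
    fun a b c d hn e => ⟨fun hxy => lt_of_le_of_ne hxy fun hxy' => hn (h _ _ _ _ (e hxy')),
      le_of_lt⟩
  refine ⟨aux 1 (-1) 0 0 (by simp) ?_, aux 1 1 0 0 (by simp) ?_, aux 1 0 (-1) 0 (by simp) ?_,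
    aux 1 0 1 0 (by simp) ?_, aux 0 2 0 (-1) (by simp) ?_, aux 0 2 0 1 (by simp) ?_,
    aux 0 0 2 (-1) (by simp) ?_, aux 0 0 2 1 (by simp) ?_⟩
  all_goals
    intro e
    push_cast
    linarith

theorem Generic.disk_strict {s t : ℝ} (h : Generic s t) :
    (s ^ 2 + t ^ 2 ≤ 1 / 2 ↔ s ^ 2 + t ^ 2 < 1 / 2) ∧
    ((s - 1) ^ 2 + t ^ 2 ≤ 1 / 2 ↔ (s - 1) ^ 2 + t ^ 2 < 1 / 2) ∧
    ((s + 1) ^ 2 + t ^ 2 ≤ 1 / 2 ↔ (s + 1) ^ 2 + t ^ 2 < 1 / 2) ∧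
    (s ^ 2 + (t - 1) ^ 2 ≤ 1 / 2 ↔ s ^ 2 + (t - 1) ^ 2 < 1 / 2) ∧
    (s ^ 2 + (t + 1) ^ 2 ≤ 1 / 2 ↔ s ^ 2 + (t + 1) ^ 2 < 1 / 2) := by
  have aux : ∀ i j : ℤ, (s + i) ^ 2 + (t + j) ^ 2 ≤ 1 / 2 ↔ (s + i) ^ 2 + (t + j) ^ 2 < 1 / 2 :=
    fun i j => ⟨fun hle => lt_of_le_of_ne hle (h.add_int i j).sq_add_sq_ne_half, le_of_lt⟩
  refine ⟨?_, ?_, ?_, ?_, ?_⟩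
  · simpa using aux 0 0
  · simpa [sub_eq_add_neg] using aux (-1) 0
  · simpa using aux 1 0
  · simpa [sub_eq_add_neg] using aux 0 (-1)
  · simpa using aux 0 1

/-- The open disks defining K₂, …, K₅ are pairwise disjoint, so a generic z lies in at most one of
these pieces, and the union of products turns into a conjunction of implications. -/
theorem mem_Ω_iff {z w : ℂ} (hz : Generic (sc z) (tc z)) (hw : Generic (sc w) (tc w)) :
    (z, (w : OnePoint ℂ)) ∈ Ω ↔ InΩ (sc z) (tc z) (sc w) (tc w) := by
  obtain ⟨z0, z1, z2, z3, z4⟩ := hz.disk_strict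
  obtain ⟨w1, w2, w3, w4, w5, w6, w7, w8⟩ := hw.strict
  have dis : ∀ a b c d : ℝ, 2 ≤ (a - c) ^ 2 + (b - d) ^ 2 →
      (sc z - a) ^ 2 + (tc z - b) ^ 2 < 1 / 2 → ¬ (sc z - c) ^ 2 + (tc z - d) ^ 2 < 1 / 2 :=
    fun a b c d h h1 => (disk_disjoint h h1).le.not_gt
  have d12 := dis 1 0 (-1) 0 (by norm_num)
  have d13 := dis 1 0 0 1 (by norm_num)
  have d14 := dis 1 0 0 (-1) (by norm_num)
  have d23 := dis (-1) 0 0 1 (by norm_num)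
  have d24 := dis (-1) 0 0 (-1) (by norm_num)
  have d34 := dis 0 1 0 (-1) (by norm_num)
  simp only [sub_neg_eq_add, sub_zero] at d12 d13 d14 d23 d24 d34
  simp only [Ω, Set.mem_union, Set.mem_prod, mem_K₁_iff, mem_K₂_iff, mem_K₃_iff, mem_K₄_iff,
    mem_K₅_iff, coe_mem_L₂_iff, coe_mem_L₃_iff, coe_mem_L₄_iff, coe_mem_L₅_iff, coe_mem_L₁_iff,
    InΩ, z0, z1, z2, z3, z4, w1, w2, w3, w4, w5, w6, w7, w8]
  clear dis z0 z1 z2 z3 z4 w1 w2 w3 w4 w5 w6 w7 w8 hz hw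
  by_cases h0 : sc z ^ 2 + tc z ^ 2 < 1 / 2 <;>
  by_cases h1 : (sc z - 1) ^ 2 + tc z ^ 2 < 1 / 2 <;>
  by_cases h2 : (sc z + 1) ^ 2 + tc z ^ 2 < 1 / 2 <;>
  by_cases h3 : sc z ^ 2 + (tc z - 1) ^ 2 < 1 / 2 <;>
  by_cases h4 : sc z ^ 2 + (tc z + 1) ^ 2 < 1 / 2 <;>
  simp only [h0, h1, h2, h3, h4, true_and, false_and, and_true, and_false, not_true, not_false_iff,
    or_false, false_or, true_imp_iff, false_imp_iff, imp_false] at *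

/-! ### Almost every point is generic -/

theorem volume_circle_or_line (a b c d : ℝ) (h : ¬ (a = 0 ∧ b = 0 ∧ c = 0 ∧ d = 0)) :
    volume {z : ℂ | a * (sc z ^ 2 + tc z ^ 2) + b * sc z + c * tc z + d = 0} = 0 := by
  by_cases ha : a = 0
  · subst ha
    by_cases hbc : b = 0 ∧ c = 0
    · obtain ⟨rfl, rfl⟩ := hbc
      have hd : d ≠ 0 := fun hd => h ⟨rfl, rfl, rfl, hd⟩
      simp [hd]
    · let f : ℂ →ₗ[ℝ] ℝ :=
        { toFun := fun z => b * sc z + c * tc z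
          map_add' := fun z w => by simp only [sc_add, tc_add]; ring
          map_smul' := fun r z => by simp [sc, tc]; ring }
      have hf : LinearMap.ker f ≠ ⊤ := by
        intro hker
        rw [LinearMap.ker_eq_top] at hker
        have h1 : f (1 + Complex.I) = 0 := by rw [hker]; rfl
        have h2 : f (1 - Complex.I) = 0 := by rw [hker]; rfl
        simp [f] at h1 h2
        exact hbc ⟨h1, h2⟩
      rcases Set.eq_empty_or_nonempty
        {z : ℂ | 0 * (sc z ^ 2 + tc z ^ 2) + b * sc z + c * tc z + d = 0} with he | ⟨z₀, hz₀⟩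
      · rw [he, measure_empty]
      · refine measure_mono_null ?_ (Measure.addHaar_affineSubspace volume
          (AffineSubspace.mk' z₀ (LinearMap.ker f)) fun ht => hf ?_)
        · intro z hz
          simp only [Set.mem_ofPred_eq, zero_mul, zero_add] at hz hz₀
          simp only [SetLike.mem_coe, AffineSubspace.mem_mk', vsub_eq_sub, LinearMap.mem_ker,
            map_sub]
          change b * sc z + c * tc z - (b * sc z₀ + c * tc z₀) = 0
          linarith
        · rw [← AffineSubspace.direction_mk' z₀ (LinearMap.ker f), ht,
            AffineSubspace.direction_top]
  -- The centre comes from completing the square: its coordinates are -b/(2a) and -c/(2a).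
  · let z₀ : ℂ := ⟨(-b - c) / (2 * a), (c - b) / (2 * a)⟩
    have hs : sc z₀ = -b / (2 * a) := by simp only [sc, z₀]; field_simp; ring
    have ht : tc z₀ = -c / (2 * a) := by simp only [tc, z₀]; field_simp; ring
    -- The squared radius doubles since |z|² = 2(s² + t²). Writing the norm as a square root too
    -- makes the sign of the radicand irrelevant.
    refine measure_mono_null ?_ (Measure.addHaar_sphere volume z₀
      (Real.sqrt ((b ^ 2 + c ^ 2 - 4 * a * d) / (2 * a ^ 2))))
    intro z hz
    rw [mem_sphere_iff_norm, eq_comm, ← Real.sqrt_sq (norm_nonneg (z - z₀)), sq_norm_eq, sc_sub,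
      tc_sub, hs, ht]
    congr 1
    simp only [Set.mem_ofPred_eq] at hz
    field_simp
    linear_combination (-4 * a) * hz

theorem volume_not_generic : volume {z : ℂ | ¬ Generic (sc z) (tc z)} = 0 := by
  have : {z : ℂ | ¬ Generic (sc z) (tc z)} ⊆
      ⋃ x : {x : ℤ × ℤ × ℤ × ℤ // ¬ (x.1 = 0 ∧ x.2.1 = 0 ∧ x.2.2.1 = 0 ∧ x.2.2.2 = 0)},
        {z : ℂ | (x.1.1 : ℝ) * (sc z ^ 2 + tc z ^ 2) + x.1.2.1 * sc z + x.1.2.2.1 * tc z +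
          x.1.2.2.2 = 0} := by
    intro z hz
    simp only [Set.mem_ofPred_eq, Generic, not_forall] at hz
    obtain ⟨a, b, c, d, h, hn⟩ := hz
    exact Set.mem_iUnion.2 ⟨⟨(a, b, c, d), hn⟩, h⟩
  refine measure_mono_null this (measure_iUnion_null fun x => volume_circle_or_line _ _ _ _ ?_)
  simpa using x.2

/-- The points one of whose coordinates is not generic. -/
def nonGeneric : Set (ℂ × OnePoint ℂ) :=
  {p | ¬ (Generic (sc p.1) (tc p.1) ∧ ∃ w : ℂ, p.2 = w ∧ Generic (sc w) (tc w))}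

theorem isNull_nonGeneric : IsNull nonGeneric := by
  have : {p : ℂ × ℂ | (p.1, (p.2 : OnePoint ℂ)) ∈ nonGeneric} ⊆
      Prod.fst ⁻¹' {z : ℂ | ¬ Generic (sc z) (tc z)} ∪
        Prod.snd ⁻¹' {z : ℂ | ¬ Generic (sc z) (tc z)} := by
    rintro ⟨z, w⟩ h
    simp only [nonGeneric, Set.mem_ofPred_eq, not_and_or] at h
    rcases h with h | h
    · exact Or.inl h
    · exact Or.inr fun hw => h ⟨w, rfl, hw⟩
  exact measure_mono_null this (measure_union_null
    (Measure.quasiMeasurePreserving_fst.preimage_null volume_not_generic)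
    (Measure.quasiMeasurePreserving_snd.preimage_null volume_not_generic))

theorem mem_Ω_diff_nonGeneric {p : ℂ × OnePoint ℂ} : p ∈ Ω \ nonGeneric ↔
    ∃ z w : ℂ, p = (z, (w : OnePoint ℂ)) ∧ Generic (sc z) (tc z) ∧ Generic (sc w) (tc w) ∧
      InΩ (sc z) (tc z) (sc w) (tc w) := by
  constructor
  · rintro ⟨hΩ, hN⟩
    obtain ⟨z, w'⟩ := p
    simp only [nonGeneric, Set.mem_ofPred_eq, not_not] at hN
    obtain ⟨hz, w, rfl, hw⟩ := hN
    exact ⟨z, w, rfl, hz, hw, (mem_Ω_iff hz hw).1 hΩ⟩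
  · rintro ⟨z, w, rfl, hz, hw, h⟩
    exact ⟨(mem_Ω_iff hz hw).2 h, fun hN => hN ⟨hz, w, rfl, hw⟩⟩

/-! ### Bijectivity -/

theorem Generic.neg_one_div {z : ℂ} (hz : Generic (sc z) (tc z)) :
    Generic (sc (-1 / z)) (tc (-1 / z)) := by
  rw [sc_neg_one_div, tc_neg_one_div]
  exact hz.inv hz.sq_add_sq_ne_zero

theorem Generic.ne_zero {z : ℂ} (hz : Generic (sc z) (tc z)) : z ≠ 0 := by
  rintro rfl
  exact hz.sq_add_sq_ne_zero (by simp [sc, tc])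

theorem Ghat_coe (c : ℂ → GaussianInt) (z : ℂ) {w : ℂ} (hw : w ≠ 0) :
    Ghat c (z, (w : OnePoint ℂ)) =
      (-1 / z - (c (-1 / z) : ℂ), ((-1 / w - (c (-1 / z) : ℂ) : ℂ) : OnePoint ℂ)) := by
  have : S (w : OnePoint ℂ) = ((-1 / w : ℂ) : OnePoint ℂ) := if_neg hw
  simp [Ghat, T, this, sub_eq_add_neg]

theorem InSΩ.abs_lt_half {s t p q : ℝ} (h : InSΩ s t p q) : |p| < 1 / 2 ∧ |q| < 1 / 2 := by
  obtain ⟨-, ⟨h1, h2, h3, h4⟩, -⟩ := h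
  exact ⟨abs_lt.2 ⟨by linarith, h1⟩, abs_lt.2 ⟨by linarith, h3⟩⟩

theorem inΩ_iff_inSΩ_neg_one_div {z w : ℂ} (hz : Generic (sc z) (tc z))
    (hw : Generic (sc w) (tc w)) : InΩ (sc z) (tc z) (sc w) (tc w) ↔
      InSΩ (sc (-1 / z)) (tc (-1 / z)) (sc (-1 / w)) (tc (-1 / w)) := by
  rw [inΩ_iff_inSΩ hz.sq_add_sq_ne_zero hw.sq_add_sq_ne_zero hz.sq_add_sq_ne_half]
  simp only [sc_neg_one_div, tc_neg_one_div]

theorem int_eq_of_abs_lt {x y : ℝ} {n k : ℤ} (hx : |x| < 1 / 2) (hy : |y| < 1 / 2)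
    (h : x - n = y - k) : n = k := by
  obtain ⟨h1, h2⟩ := abs_lt.1 hx
  obtain ⟨h3, h4⟩ := abs_lt.1 hy
  have h5 : ((n - k : ℤ) : ℝ) < (1 : ℤ) := by push_cast; linarith
  have h6 : ((-1 : ℤ) : ℝ) < (n - k : ℤ) := by push_cast; linarith
  have := Int.cast_lt.1 h5
  have := Int.cast_lt.1 h6
  omega

theorem neg_one_div_neg_one_div (z : ℂ) : -1 / (-1 / z) = z := by
  rw [div_div_eq_mul_div, neg_one_mul, neg_div_neg_eq, div_one]

/-- One step of the natural extension at a generic point of `Ω`. -/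
theorem IsDiskChoice.step {c : ℂ → GaussianInt} (hc : IsDiskChoice c) {z w : ℂ}
    (hz : Generic (sc z) (tc z)) (hw : Generic (sc w) (tc w))
    (h : InΩ (sc z) (tc z) (sc w) (tc w)) :
    ∃ n m : ℤ, c (-1 / z) = ⟨n + m, n - m⟩ ∧ |sc (-1 / w)| < 1 / 2 ∧ |tc (-1 / w)| < 1 / 2 ∧
      InΩ (sc (-1 / z) - n) (tc (-1 / z) - m) (sc (-1 / w) - n) (tc (-1 / w) - m) := by
  have hS := (inΩ_iff_inSΩ_neg_one_div hz hw).1 h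
  obtain ⟨n, m, e, hV⟩ := hc.exists_inV hz.neg_one_div
  refine ⟨n, m, e, hS.abs_lt_half.1, hS.abs_lt_half.2,
    (translationStep n m hS.abs_lt_half.1 hS.abs_lt_half.2).1 ⟨hV, ?_⟩⟩
  simpa only [sub_add_cancel] using hS

theorem mapsTo_Ghat {c : ℂ → GaussianInt} (hc : IsDiskChoice c) :
    Set.MapsTo (Ghat c) (Ω \ nonGeneric) (Ω \ nonGeneric) := by
  intro p hp
  obtain ⟨z, w, rfl, hz, hw, h⟩ := mem_Ω_diff_nonGeneric.1 hp
  obtain ⟨n, m, e, -, -, h'⟩ := hc.step hz hw h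
  rw [Ghat_coe c z hw.ne_zero, e]
  refine mem_Ω_diff_nonGeneric.2 ⟨_, _, rfl, ?_, ?_, ?_⟩ <;>
    simp only [sc_sub, tc_sub, sc_gaussian, tc_gaussian]
  · exact hz.neg_one_div.sub_int n m
  · exact hw.neg_one_div.sub_int n m
  · exact h'

/-- Both -1/w and -1/w' lie in the open square, so equal second coordinates of the images force
equal digits; undoing the translation and S then gives equal points. -/
theorem injOn_Ghat {c : ℂ → GaussianInt} (hc : IsDiskChoice c) :
    Set.InjOn (Ghat c) (Ω \ nonGeneric) := by
  intro p hp p' hp' heq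
  obtain ⟨z, w, rfl, hz, hw, h⟩ := mem_Ω_diff_nonGeneric.1 hp
  obtain ⟨z', w', rfl, hz', hw', h'⟩ := mem_Ω_diff_nonGeneric.1 hp'
  obtain ⟨n, m, e, hp, hq, -⟩ := hc.step hz hw h
  obtain ⟨n', m', e', hp', hq', -⟩ := hc.step hz' hw' h'
  rw [Ghat_coe c z hw.ne_zero, Ghat_coe c z' hw'.ne_zero, e, e', Prod.mk.injEq,
    OnePoint.coe_eq_coe] at heq
  obtain ⟨e₁, e₂⟩ := heq
  have hn : n = n' := int_eq_of_abs_lt hp hp' (by simpa using congrArg sc e₂)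
  have hm : m = m' := int_eq_of_abs_lt hq hq' (by simpa using congrArg tc e₂)
  subst hn hm
  rw [sub_left_inj] at e₁ e₂
  rw [← neg_one_div_neg_one_div z, e₁, ← neg_one_div_neg_one_div w, e₂,
    neg_one_div_neg_one_div, neg_one_div_neg_one_div]

theorem surjOn_Ghat {c : ℂ → GaussianInt} (hc : IsDiskChoice c) :
    Set.SurjOn (Ghat c) (Ω \ nonGeneric) (Ω \ nonGeneric) := by
  intro p hp
  obtain ⟨z, w, rfl, hz, hw, h⟩ := mem_Ω_diff_nonGeneric.1 hp
  -- The digit is dictated by w: it must carry w into the square.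
  obtain ⟨n, m, hn, hm⟩ := hw.exists_digit
  let a : ℂ := ((⟨n + m, n - m⟩ : GaussianInt) : ℂ)
  have hu : Generic (sc (z + a)) (tc (z + a)) := by simpa [a] using hz.add_int n m
  have hv : Generic (sc (w + a)) (tc (w + a)) := by simpa [a] using hw.add_int n m
  obtain ⟨hV, hS⟩ := (translationStep n m hn hm (s := sc z) (t := tc z)).2 (by simpa using h)
  obtain ⟨k, l, e, hV'⟩ := hc.exists_inV hu
  -- Since z lies in V(a), the choice function has no alternative to a at z + a.
  obtain ⟨rfl, rfl⟩ : n = k ∧ m = l := by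
    refine InV.digit_unique (s := sc (z + a)) (t := tc (z + a)) ?_ hV'
    simpa [a] using hV
  refine ⟨(-1 / (z + a), ((-1 / (w + a) : ℂ) : OnePoint ℂ)), mem_Ω_diff_nonGeneric.2
    ⟨_, _, rfl, hu.neg_one_div, hv.neg_one_div, ?_⟩, ?_⟩
  · rw [inΩ_iff_inSΩ_neg_one_div hu.neg_one_div hv.neg_one_div]
    simpa [neg_one_div_neg_one_div, a] using hS
  · rw [Ghat_coe c _ hv.neg_one_div.ne_zero, neg_one_div_neg_one_div, neg_one_div_neg_one_div, e]
    simp only [a, add_sub_cancel_right]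

end DiskCF

theorem mainTheorem4 (c : ℂ → GaussianInt) (hc : DiskCF.IsDiskChoice c) :
    DiskCF.BijectiveAE (DiskCF.Ghat c) DiskCF.Ω :=
  ⟨DiskCF.nonGeneric, DiskCF.isNull_nonGeneric, DiskCF.mapsTo_Ghat hc, DiskCF.injOn_Ghat hc,
    DiskCF.surjOn_Ghat hc⟩
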